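/- Let $p\ge 1$ be an integer and put $q=\lfloor p/2\rfloor$. For $m\ge 0$ let $B_m$ be the centred B-spline of degree $m$ with the equidistant knots $-\frac{m+1}{2},-\frac{m+1}{2}+1,\dots,\frac{m+1}{2}$, i.e. $B_0=\chi_{[-1/2,1/2)}$ and, for $m\ge1$, $$B_m(x)=\frac1m\Big(\big(x+\tfrac{m+1}{2}\big)B_{m-1}\big(x+\tfrac12\big)+\big(\tfrac{m+1}{2}-x\big)B_{m-1}\big(x-\tfrac12\big)\Big).$$ Let $c_{p,j}$, $|j|\le q$, be the coefficients of the quasi-interpolation operator $Q_pP(x)=\sum_{n\in\mathbb Z}\big(\sum_{j=-q}^{q}c_{p,j}P(n+j)\big)B_p(x-n)$ that reproduces the polynomials of degree at most $p$; explicitly $$c_{p,j}=\sum_{l=|j|}^{q}(-1)^{l+|j|}\binom{2l}{l+|j|}\frac{(p+1)!}{(2l+p+1)!}\,t(2l+p+1,p+1),$$ where the central factorial numbers $t(n,k)$ are given by $x\prod_{i=1}^{n-1}\big(x+\frac n2-i\big)=\sum_k t(n,k)x^k$; put $c_{p,j}=0$ for $|j|>q$. Define $$\tau_{p,j}=\sum_{r=j-1-q}^{j+q}c_{p,r}\,B_{p+1}\big(r-j+\tfrac12\big),\qquad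 \xi_{p,i}=\sum_{j=-2q}^{i}\tau_{p,j}.$$ For real $a<b$, an integer $N\ge1$, $h_N=\frac{b-a}{N}$ and $x_i=a+ih_N$ ($i\in\mathbb Z$), define the corrected trapezoidal rule $$T^p_{[a,b],N}(f)=\frac{h_N}{2}\big(f(x_0)+f(x_N)\big)+h_N\sum_{i=1}^{N-1}f(x_i)+h_N\sum_{i=1}^{2q}\xi_{p,-i}\big(f(x_{-i})-f(x_i)+f(x_{N+i})-f(x_{N-i})\big).$$ Let $N_0\ge1$ and let $f$ be a real function of class $C^{p+1}$ if $p$ is odd, and of class $C^{p+2}$ if $p$ is even, on the interval $\Omega=[a-2q h_{N_0},\,b+2q h_{N_0}]$. Then $$\Big|\int_a^b f(x)\,dx-T^p_{[a,b],N}(f)\Big|=\begin{cases}O(h_N^{p+1}),&p\text{ odd},\\ O(h_N^{p+2}),&p\text{ even},\end{cases}$$ that is, there is a constant $K$, independent of $N$, such that for all $N\ge N_0$ the error is at most $K h_N^{p+1}$ if $p$ is odd and at most $K h_N^{p+2}$ if $p$ is even. -/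

import Mathlib

noncomputable section

open Polynomial

namespace BSplineQuadrature

/-- The centred cardinal B-spline of degree `p`, with knots `-(p+1)/2, …, (p+1)/2` and
support `[-(p+1)/2, (p+1)/2]`, given by the Cox–de Boor recursion. -/
def bspline : ℕ → ℝ → ℝ
  | 0, x => if -(1 / 2) ≤ x ∧ x < 1 / 2 then 1 else 0
  | p + 1, x =>
      ((x + ((p : ℝ) + 2) / 2) * bspline p (x + 1 / 2)
        + (((p : ℝ) + 2) / 2 - x) * bspline p (x - 1 / 2)) / ((p : ℝ) + 1)

/-- The central factorial polynomial `x ∏_{i=1}^{n-1} (x + n/2 - i)` (used for `n ≥ 1`). -/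
def centralFactorialPoly (n : ℕ) : ℝ[X] :=
  X * ∏ i ∈ Finset.Icc 1 (n - 1), (X + C ((n : ℝ) / 2 - (i : ℝ)))

/-- The central factorial numbers of the first kind `t(n, k)`. -/
def centralFactorialNumber (n k : ℕ) : ℝ :=
  (centralFactorialPoly n).coeff k

/-- The coefficients `c_{p,j}` of the quasi-interpolation operator
`Q_p f (x) = ∑ₙ (∑ⱼ c_{p,j} f (n+j)) B_p (x-n)` that reproduces the polynomials of degree at
most `p`, in closed form; here `c_{p,j} = 0` for `|j| > ⌊p/2⌋`, and `c_{p,-j} = c_{p,j}`. -/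
def coeffC (p : ℕ) (j : ℤ) : ℝ :=
  ∑ l ∈ Finset.Icc j.natAbs (p / 2),
    (-1 : ℝ) ^ (l + j.natAbs) * ((2 * l).choose (l + j.natAbs) : ℝ)
      * (((p + 1).factorial : ℝ) / ((2 * l + p + 1).factorial : ℝ)
        * centralFactorialNumber (2 * l + p + 1) (p + 1))

/-- The B-integration terms
`τ_{p,j} = ∑_{r=j-1-⌊p/2⌋}^{j+⌊p/2⌋} c_{p,r} B_{p+1}(r - j + 1/2)`. -/
def tau (p : ℕ) (j : ℤ) : ℝ :=
  ∑ r ∈ Finset.Icc (j - 1 - ((p / 2 : ℕ) : ℤ)) (j + ((p / 2 : ℕ) : ℤ)),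
    coeffC p r * bspline (p + 1) ((r : ℝ) - (j : ℝ) + 1 / 2)

/-- The partial sums `ξ_{p,i} = ∑_{j=-2⌊p/2⌋}^{i} τ_{p,j}`. -/
def xi (p : ℕ) (i : ℤ) : ℝ :=
  ∑ j ∈ Finset.Icc (-(2 * ((p / 2 : ℕ) : ℤ))) i, tau p j

/-- The mesh size `h = (b - a) / N`. -/
def mesh (a b : ℝ) (N : ℕ) : ℝ := (b - a) / (N : ℝ)

/-- The nodes `x_i = a + i h`, for every integer `i`. -/
def node (a b : ℝ) (N : ℕ) (i : ℤ) : ℝ := a + (i : ℝ) * mesh a b N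

/-- The classical composite trapezoidal rule `T_{[a,b],N}`. -/
def trapezoid (f : ℝ → ℝ) (a b : ℝ) (N : ℕ) : ℝ :=
  mesh a b N / 2 * (f (node a b N 0) + f (node a b N N))
    + mesh a b N * ∑ i ∈ Finset.Icc 1 (N - 1), f (node a b N i)

/-- The corrected trapezoidal rule `T^p_{[a,b],N}`. -/
def correctedTrapezoid (p : ℕ) (f : ℝ → ℝ) (a b : ℝ) (N : ℕ) : ℝ :=
  trapezoid f a b N
    + mesh a b N * ∑ i ∈ Finset.Icc 1 (2 * (p / 2)),
        xi p (-(i : ℤ))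
          * (f (node a b N (-(i : ℤ))) - f (node a b N (i : ℤ))
            + f (node a b N ((N : ℤ) + (i : ℤ))) - f (node a b N ((N : ℤ) - (i : ℤ))))

/-- The extended interval `Ω = [a - 2⌊p/2⌋h, b + 2⌊p/2⌋h]`, with `h = (b - a) / N`. -/
def extendedInterval (p : ℕ) (a b : ℝ) (N : ℕ) : Set ℝ :=
  Set.Icc (a - 2 * ((p / 2 : ℕ) : ℝ) * mesh a b N) (b + 2 * ((p / 2 : ℕ) : ℝ) * mesh a b N)

end BSplineQuadrature

end

open BSplineQuadrature

noncomputable section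

open Polynomial

namespace BSplineQuadrature

/-! Write q = ⌊p/2⌋. Summation by parts, with `tau p (1 - j) = tau p j`, shows that the corrected
rule is the sum over the N panels of one local rule, ∫_{x_k}^{x_{k+1}} f ≈ h ∑_j τ_{p,j} f(x_{k+j}):
interior corrections cancel between neighbouring panels and only those at the two ends survive
(`correctedTrapezoid_eq_sum`). If the local rule is exact in degree ≤ 2q+1, a Taylor estimate gives
O(h^{2q+3}) per panel, hence O(h^{2q+2}) in total, which is p+1 for odd p and p+2 for even p.

Exactness in degree ≤ p is tested on translates of `knotPoly p`, the polynomial in Marsden's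
identity. That identity in degree p+1 evaluates ∑_j τ_{p,j} `knotPoly (p+1)`(y-j) as ∑_r c_{p,r}
(y-1/2-r)^{p+1}; a central difference in y then gives the integral of `knotPoly p`, provided that
∑_r c_{p,r} (z-r)^p = `knotPoly p`(z). Differencing in z reaches lower degrees, and for even p the
symmetry about 1/2 gains one more.

The identity for c_{p,r} is umbral calculus. With D = d/dx, δ = D·M(D) and M = 2 sinh(t/2)/t, one
has `knotPoly p` = M(D)^{-(p+1)} x^p, and Newton's formula expands D^{p+1} in powers of δ with
central factorial numbers as coefficients. -/

open PowerSeries (trunc)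

/-! ### Formal differential operators on polynomials -/

/-- A power series `φ`, as the formal differential operator `φ(d/dx)` on polynomials. -/
def act (φ : PowerSeries ℝ) (P : ℝ[X]) : ℝ[X] :=
  aeval (derivative : Module.End ℝ ℝ[X]) (trunc (P.natDegree + 1) φ) P

theorem aeval_derivative_eq_zero {N : ℕ} {A P : ℝ[X]} (hP : P.natDegree < N) (hA : X ^ N ∣ A) :
    aeval (derivative : Module.End ℝ ℝ[X]) A P = 0 := by
  obtain ⟨B, rfl⟩ := hA
  rw [mul_comm, map_mul, map_pow, aeval_X, Module.End.mul_apply, Module.End.pow_apply,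
    iterate_derivative_eq_zero hP, map_zero]

theorem aeval_derivative_congr {N : ℕ} {A B P : ℝ[X]} (hP : P.natDegree < N)
    (h : ∀ i < N, A.coeff i = B.coeff i) :
    aeval (derivative : Module.End ℝ ℝ[X]) A P = aeval (derivative : Module.End ℝ ℝ[X]) B P := by
  rw [← sub_eq_zero, ← LinearMap.sub_apply, ← map_sub]
  refine aeval_derivative_eq_zero hP (X_pow_dvd_iff.2 fun i hi => ?_)
  rw [coeff_sub, h i hi, sub_self]

/-- Derivatives beyond the degree vanish, so every long enough truncation gives the same result;
polynomials of different degrees can then share one truncation. -/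
theorem act_eq_aeval (φ : PowerSeries ℝ) {P : ℝ[X]} {N : ℕ} (hP : P.natDegree < N) :
    act φ P = aeval (derivative : Module.End ℝ ℝ[X]) (trunc N φ) P := by
  refine aeval_derivative_congr (Nat.lt_succ_self _) fun i hi => ?_
  rw [PowerSeries.coeff_trunc, PowerSeries.coeff_trunc, if_pos hi, if_pos (by omega)]

theorem act_eq_sum (φ : PowerSeries ℝ) {P : ℝ[X]} {N : ℕ} (hP : P.natDegree < N) :
    act φ P = ∑ i ∈ Finset.range N, PowerSeries.coeff i φ • derivative^[i] P := by
  rw [act_eq_aeval φ hP, PowerSeries.trunc_apply, ← Finset.range_eq_Ico, map_sum,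
    LinearMap.sum_apply]
  refine Finset.sum_congr rfl fun i _ => ?_
  rw [aeval_monomial, Module.End.mul_apply, Module.End.pow_apply, Module.algebraMap_end_apply]

theorem natDegree_act_le (φ : PowerSeries ℝ) (P : ℝ[X]) : (act φ P).natDegree ≤ P.natDegree := by
  rw [act_eq_sum φ (Nat.lt_succ_self _)]
  refine natDegree_sum_le_of_forall_le _ _ fun i _ => (natDegree_smul_le _ _).trans ?_
  exact (natDegree_iterate_derivative P i).trans (Nat.sub_le _ _)

theorem act_smul_right (φ : PowerSeries ℝ) (c : ℝ) (P : ℝ[X]) : act φ (c • P) = c • act φ P := by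
  rw [act_eq_aeval φ (Nat.lt_succ_of_le (natDegree_smul_le c P)),
    act_eq_aeval φ (Nat.lt_succ_self _), map_smul]

theorem act_add_left (φ ψ : PowerSeries ℝ) (P : ℝ[X]) : act (φ + ψ) P = act φ P + act ψ P := by
  simp only [act, map_add, LinearMap.add_apply]

theorem act_smul_left (c : ℝ) (φ : PowerSeries ℝ) (P : ℝ[X]) : act (c • φ) P = c • act φ P := by
  simp only [act, map_smul, LinearMap.smul_apply]

theorem act_mul (φ ψ : PowerSeries ℝ) (P : ℝ[X]) : act (φ * ψ) P = act φ (act ψ P) := by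
  have hN : P.natDegree < P.natDegree + 1 := Nat.lt_succ_self _
  rw [act_eq_aeval φ ((natDegree_act_le ψ P).trans_lt hN), act_eq_aeval ψ hN, act_eq_aeval _ hN,
    ← Module.End.mul_apply, ← map_mul]
  refine aeval_derivative_congr hN fun i hi => ?_
  rw [← PowerSeries.trunc_trunc_mul_trunc, PowerSeries.coeff_trunc, if_pos hi,
    ← Polynomial.coe_mul, Polynomial.coeff_coe]

theorem act_one (P : ℝ[X]) : act 1 P = P := by
  rw [act, PowerSeries.trunc_one, map_one, Module.End.one_apply]

theorem act_X (P : ℝ[X]) : act PowerSeries.X P = derivative P := by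
  rw [act_eq_aeval _ (show P.natDegree < P.natDegree + 2 by omega), PowerSeries.trunc_X, aeval_X]

theorem act_X_pow (n : ℕ) (P : ℝ[X]) : act (PowerSeries.X ^ n) P = derivative^[n] P := by
  induction n generalizing P with
  | zero => rw [pow_zero, act_one, Function.iterate_zero_apply]
  | succ n ih => rw [pow_succ, act_mul, act_X, ih, Function.iterate_succ_apply]

theorem iterate_derivative_X_mul' (n : ℕ) (P : ℝ[X]) :
    derivative^[n + 1] (X * P) = X * derivative^[n + 1] P + ((n : ℝ) + 1) • derivative^[n] P := by
  induction n with
  | zero => simp [add_comm]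
  | succ n ih =>
    rw [Function.iterate_succ_apply', ih, derivative_add, derivative_mul, derivative_X, one_mul,
      derivative_smul, ← Function.iterate_succ_apply' derivative,
      ← Function.iterate_succ_apply' derivative]
    push_cast
    module

/-- The commutator rule [φ(D), x] = φ'(D), a form of Leibniz' rule. -/
theorem act_X_mul (φ : PowerSeries ℝ) (P : ℝ[X]) :
    act φ (X * P) = X * act φ P + act (PowerSeries.derivative ℝ φ) P := by
  have h1 : (X * P).natDegree < P.natDegree + 2 :=
    (natDegree_mul_le.trans (by rw [natDegree_X]; omega : _ ≤ P.natDegree + 1)).trans_lt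
      (Nat.lt_succ_self _)
  rw [act_eq_sum φ h1, act_eq_sum φ (show P.natDegree < P.natDegree + 2 by omega),
    act_eq_sum (PowerSeries.derivative ℝ φ) (Nat.lt_succ_self P.natDegree),
    Finset.sum_range_succ', Finset.sum_range_succ' _ (P.natDegree + 1), mul_add, Finset.mul_sum,
    add_right_comm, ← Finset.sum_add_distrib]
  congr 1
  · refine Finset.sum_congr rfl fun i _ => ?_
    rw [iterate_derivative_X_mul', smul_add, mul_smul_comm, PowerSeries.coeff_derivative, smul_smul]
  · simp

/-! ### The central difference operator -/

/-- The central difference operator `δP(x) = P(x + 1/2) - P(x - 1/2)`. -/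
def centralDiff : ℝ[X] →ₗ[ℝ] ℝ[X] := taylor (1 / 2) - taylor (-(1 / 2))

theorem eval_centralDiff (P : ℝ[X]) (x : ℝ) :
    (centralDiff P).eval x = P.eval (x + 1 / 2) - P.eval (x - 1 / 2) := by
  simp [centralDiff, taylor_apply, sub_eq_add_neg]

theorem centralDiff_taylor (P : ℝ[X]) (y : ℝ) :
    centralDiff (taylor y P) = taylor y (centralDiff P) := by
  simp only [centralDiff, LinearMap.sub_apply, map_sub, taylor_taylor, add_comm]

theorem iterate_centralDiff_taylor (n : ℕ) (P : ℝ[X]) (y : ℝ) :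
    centralDiff^[n] (taylor y P) = taylor y (centralDiff^[n] P) := by
  induction n generalizing P with
  | zero => rfl
  | succ n ih => rw [Function.iterate_succ_apply, centralDiff_taylor, ih,
      Function.iterate_succ_apply]

/-- The power series `2 sinh(t/2) / t`, the symbol of the mean over intervals of length one. -/
def meanSeries : PowerSeries ℝ :=
  PowerSeries.mk fun i => ((1 / 2) ^ (i + 1) - (-(1 / 2)) ^ (i + 1)) / (i + 1).factorial

/-- Translation by r is exp(rD). -/
theorem taylor_eq_act (r : ℝ) (P : ℝ[X]) :
    taylor r P = act (PowerSeries.mk fun i => r ^ i / i.factorial) P := by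
  refine Polynomial.funext fun x => ?_
  rw [act_eq_sum _ (Nat.lt_succ_self _), taylor_eval, add_comm x r, ← taylor_eval,
    eval_eq_sum_range' (n := P.natDegree + 1) (by rw [natDegree_taylor]; omega), eval_finsetSum]
  refine Finset.sum_congr rfl fun i _ => ?_
  rw [taylor_coeff, ← factorial_smul_hasseDeriv, PowerSeries.coeff_mk, eval_smul,
    LinearMap.smul_apply, eval_smul, smul_eq_mul, nsmul_eq_mul]
  have : (i.factorial : ℝ) ≠ 0 := by positivity
  field_simp

theorem centralDiff_eq_act (P : ℝ[X]) :
    centralDiff P = act (PowerSeries.X * meanSeries) P := by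
  have h : (PowerSeries.X * meanSeries : PowerSeries ℝ) =
      (PowerSeries.mk fun i => (1 / 2 : ℝ) ^ i / i.factorial)
        + (-1 : ℝ) • PowerSeries.mk fun i => (-(1 / 2) : ℝ) ^ i / i.factorial := by
    ext i
    cases i with
    | zero => simp
    | succ i =>
      rw [PowerSeries.coeff_succ_X_mul, meanSeries]
      simp only [PowerSeries.coeff_mk, map_add, map_smul, smul_eq_mul]
      ring
  rw [h, act_add_left, act_smul_left, ← taylor_eq_act, ← taylor_eq_act, centralDiff,
    LinearMap.sub_apply, neg_one_smul, sub_eq_add_neg]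

theorem constantCoeff_meanSeries : PowerSeries.constantCoeff meanSeries = 1 := by
  rw [← PowerSeries.coeff_zero_eq_constantCoeff_apply, meanSeries, PowerSeries.coeff_mk]
  norm_num

theorem meanSeries_mul_inv : meanSeries * meanSeries⁻¹ = 1 :=
  PowerSeries.mul_inv_cancel _ (by rw [constantCoeff_meanSeries]; exact one_ne_zero)

theorem iterate_centralDiff_eq_act (n : ℕ) (P : ℝ[X]) :
    centralDiff^[n] P = act ((PowerSeries.X * meanSeries) ^ n) P := by
  induction n generalizing P with
  | zero => rw [pow_zero, act_one, Function.iterate_zero_apply]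
  | succ n ih => rw [pow_succ, act_mul, ← centralDiff_eq_act, ← ih, Function.iterate_succ_apply]

/-- Since δ = D·M(D) with M invertible, the kernel of δ is that of D, the constants. -/
theorem eq_of_centralDiff_eq {P Q : ℝ[X]} (h : centralDiff P = centralDiff Q)
    (h0 : P.eval 0 = Q.eval 0) : P = Q := by
  have hd : derivative (P - Q) = 0 := by
    have h1 : centralDiff (P - Q) = 0 := by rw [map_sub, h, sub_self]
    have h2 : act meanSeries⁻¹ (centralDiff (P - Q)) = 0 := by
      rw [h1]; simp [act]
    rwa [centralDiff_eq_act, ← act_mul, mul_left_comm, mul_comm meanSeries⁻¹, meanSeries_mul_inv,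
      mul_one, act_X] at h2
  have hc := derivative_eq_zero.1 hd
  rw [natDegree_eq_zero] at hc
  obtain ⟨c, hc⟩ := hc
  have : c = 0 := by
    have := congrArg (eval 0) hc
    simpa [h0] using this
  rw [← sub_eq_zero, ← hc, this, C_0]

theorem degree_centralDiff_lt {P : ℝ[X]} {N : ℕ} (h : P.degree < (N + 1 : ℕ)) :
    (centralDiff P).degree < N := by
  rw [centralDiff_eq_act, act_mul, act_X]
  by_cases h0 : act meanSeries P = 0
  · rw [h0, derivative_zero, degree_zero]; exact WithBot.bot_lt_coe N
  · have h1 := degree_derivative_lt h0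
    have h2 : (act meanSeries P).natDegree ≤ N := by
      refine (natDegree_act_le _ _).trans ?_
      by_cases hP : P = 0
      · simp [hP]
      · have := (natDegree_lt_iff_degree_lt hP).2 h
        omega
    exact h1.trans_le (natDegree_le_iff_degree_le.1 h2)

/-! ### Central factorial polynomials -/

/-- The polynomial `∏_{i<n} (x + (n-1)/2 - i)`, whose zeros are the interior knots of the centred
B-spline of degree `n`. -/
def knotPoly (n : ℕ) : ℝ[X] :=
  ∏ i ∈ Finset.range n, (X + C (((n : ℝ) - 1) / 2 - (i : ℝ)))

theorem eval_knotPoly (n : ℕ) (x : ℝ) :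
    (knotPoly n).eval x = ∏ i ∈ Finset.range n, (x + (((n : ℝ) - 1) / 2 - (i : ℝ))) := by
  simp [knotPoly, eval_prod]

theorem monic_knotPoly (n : ℕ) : (knotPoly n).Monic :=
  monic_prod_of_monic _ _ fun _ _ => monic_X_add_C _

theorem natDegree_knotPoly (n : ℕ) : (knotPoly n).natDegree = n := by
  rw [knotPoly, natDegree_prod_of_monic _ _ fun _ _ => monic_X_add_C _]
  simp only [natDegree_X_add_C, Finset.sum_const, Finset.card_range, smul_eq_mul, mul_one]

theorem centralFactorialPoly_succ (n : ℕ) : centralFactorialPoly (n + 1) = X * knotPoly n := by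
  rw [centralFactorialPoly, knotPoly, Nat.add_sub_cancel, Finset.range_eq_Ico,
    ← Finset.Ico_add_one_right_eq_Icc, Finset.prod_Ico_eq_prod_range, Finset.range_eq_Ico,
    Nat.add_sub_cancel]
  refine congrArg _ (Finset.prod_congr rfl fun i _ => ?_)
  push_cast
  congr 2
  ring

theorem eval_knotPoly_succ_add (n : ℕ) (z : ℝ) :
    (knotPoly (n + 1)).eval (z + 1 / 2) = (z + ((n : ℝ) + 1) / 2) * (knotPoly n).eval z := by
  rw [eval_knotPoly, eval_knotPoly, Finset.prod_range_succ', mul_comm]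
  congr 1
  · push_cast; ring
  · refine Finset.prod_congr rfl fun i _ => ?_
    push_cast; ring

theorem eval_knotPoly_succ_sub (n : ℕ) (z : ℝ) :
    (knotPoly (n + 1)).eval (z - 1 / 2) = (z - ((n : ℝ) + 1) / 2) * (knotPoly n).eval z := by
  rw [eval_knotPoly, eval_knotPoly, Finset.prod_range_succ, mul_comm]
  congr 1
  · push_cast; ring
  · refine Finset.prod_congr rfl fun i _ => ?_
    push_cast; ring

theorem eval_knotPoly_neg (n : ℕ) (x : ℝ) :
    (knotPoly n).eval (-x) = (-1) ^ n * (knotPoly n).eval x := by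
  induction n generalizing x with
  | zero => simp [knotPoly]
  | succ n ih =>
    rw [show -x = -(x + 1 / 2) + 1 / 2 by ring, eval_knotPoly_succ_add, ih,
      show (knotPoly (n + 1)).eval x = (knotPoly (n + 1)).eval ((x + 1 / 2) - 1 / 2) by ring_nf,
      eval_knotPoly_succ_sub]
    ring

theorem coeff_knotPoly_eq_zero {n k : ℕ} (h : Odd (n + k)) : (knotPoly n).coeff k = 0 := by
  have h1 : (knotPoly n).comp (C (-1) * X) = (-1 : ℝ) ^ n • knotPoly n :=
    Polynomial.funext fun x => by simp [eval_knotPoly_neg]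
  have h2 := congrArg (fun P : ℝ[X] => P.coeff k) h1
  simp only [coeff_smul, smul_eq_mul, comp_C_mul_X_coeff] at h2
  have h3 : (-1 : ℝ) ^ n * (-1) ^ k = -1 := by rw [← pow_add, h.neg_one_pow]
  have h4 : (-1 : ℝ) ^ n * (-1) ^ n = 1 := by
    rw [← pow_add, (Even.add_self n).neg_one_pow]
  linear_combination (-(1 / 2) * (-1 : ℝ) ^ n) * h2 + (1 / 2) * (knotPoly n).coeff k * h3
    - (1 / 2) * (knotPoly n).coeff k * h4

theorem knotPoly_zero : knotPoly 0 = 1 := rfl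

theorem centralDiff_knotPoly_succ (n : ℕ) :
    centralDiff (knotPoly (n + 1)) = ((n : ℝ) + 1) • knotPoly n := by
  refine Polynomial.funext fun x => ?_
  rw [eval_centralDiff, eval_knotPoly_succ_add, eval_knotPoly_succ_sub, eval_smul, smul_eq_mul]
  ring

/-- The central factorials: `1` for `n = 0`, and `x ∏_{i=1}^{n-1} (x + n/2 - i)` for `n ≥ 1`. -/
def centralFactorial : ℕ → ℝ[X]
  | 0 => 1
  | n + 1 => X * knotPoly n

theorem centralDiff_centralFactorial_succ (n : ℕ) :
    centralDiff (centralFactorial (n + 1)) = ((n : ℝ) + 1) • centralFactorial n := by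
  refine Polynomial.funext fun x => ?_
  cases n with
  | zero => simp [eval_centralDiff, centralFactorial, knotPoly_zero]; norm_num
  | succ n =>
    simp only [eval_centralDiff, centralFactorial, eval_mul, eval_X, eval_smul, smul_eq_mul,
      eval_knotPoly_succ_add, eval_knotPoly_succ_sub]
    push_cast
    ring

theorem act_one_right (φ : PowerSeries ℝ) : act φ 1 = C (PowerSeries.constantCoeff φ) := by
  rw [act_eq_sum φ (N := 1) (by simp), Finset.sum_range_one, Function.iterate_zero_apply,
    PowerSeries.coeff_zero_eq_constantCoeff_apply, smul_eq_C_mul, mul_one]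

theorem act_X_mul_X_pow (φ : PowerSeries ℝ) (n : ℕ) :
    act (φ * PowerSeries.X) (X ^ (n + 1)) = ((n : ℝ) + 1) • act φ (X ^ n) := by
  rw [act_mul, act_X, derivative_X_pow, Nat.add_sub_cancel, ← smul_eq_C_mul, act_smul_right]
  push_cast
  rfl

/-- Commuting x past M⁻¹ to the power n+1 turns the product into an operator applied to x^(n+1), a
form on which δ acts by multiplication of symbols. -/
theorem X_mul_act_inv_meanSeries_pow (n : ℕ) :
    X * act (meanSeries⁻¹ ^ (n + 1)) (X ^ n) =
      act (meanSeries⁻¹ ^ n * (meanSeries⁻¹ - PowerSeries.X * PowerSeries.derivative ℝ meanSeries⁻¹))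
        (X ^ (n + 1)) := by
  set G := meanSeries⁻¹
  have h := act_X_mul (G ^ (n + 1)) (X ^ n)
  have hd : PowerSeries.derivative ℝ (G ^ (n + 1)) =
      ((n : ℝ) + 1) • (G ^ n * PowerSeries.derivative ℝ G) := by
    rw [Derivation.leibniz_pow, Nat.add_sub_cancel, smul_eq_mul]
    rw [← Nat.cast_smul_eq_nsmul ℝ]
    push_cast
    rfl
  have hs : G ^ n * (G - PowerSeries.X * PowerSeries.derivative ℝ G) =
      G ^ (n + 1) + (-1 : ℝ) • (G ^ n * PowerSeries.derivative ℝ G * PowerSeries.X) := by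
    rw [neg_one_smul]; ring
  rw [hs, act_add_left, act_smul_left, act_X_mul_X_pow, pow_succ' X, h, hd, act_smul_left]
  module

/-- Both sides vanish at 0 and obey the same recursion under δ: on the right, the factor M of δ
cancels one M⁻¹ and the factor D lowers the power of x. -/
theorem centralFactorial_succ_eq_act (n : ℕ) :
    centralFactorial (n + 1) = X * act (meanSeries⁻¹ ^ (n + 1)) (X ^ n) := by
  induction n with
  | zero =>
    rw [pow_zero, act_one_right]
    simp [centralFactorial, knotPoly_zero, constantCoeff_meanSeries]
  | succ n ih =>
    refine eq_of_centralDiff_eq ?_ (by simp [centralFactorial])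
    rw [centralDiff_centralFactorial_succ, X_mul_act_inv_meanSeries_pow, centralDiff_eq_act,
      ← act_mul, ih, X_mul_act_inv_meanSeries_pow, mul_assoc, mul_comm PowerSeries.X (_ * _),
      act_X_mul_X_pow]
    push_cast
    rw [pow_succ' meanSeries⁻¹, ← mul_assoc, ← mul_assoc, meanSeries_mul_inv, one_mul]

theorem knotPoly_eq_act (n : ℕ) : knotPoly n = act (meanSeries⁻¹ ^ (n + 1)) (X ^ n) :=
  mul_left_cancel₀ X_ne_zero (centralFactorial_succ_eq_act n)

/-! ### Newton's formula and the quasi-interpolation coefficients -/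

/-- Newton's interpolation formula with central differences. -/
theorem newton_centralDiff (N : ℕ) {P : ℝ[X]} (hP : P.degree < N) :
    P = ∑ n ∈ Finset.range N, ((centralDiff^[n] P).eval 0 / n.factorial) • centralFactorial n := by
  induction N generalizing P with
  | zero =>
    rw [Finset.range_zero, Finset.sum_empty, ← degree_eq_bot]
    simpa using hP
  | succ N ih =>
    have h := ih (degree_centralDiff_lt hP)
    rw [Finset.sum_range_succ']
    refine eq_of_centralDiff_eq ?_ ?_
    · rw [map_add, map_sum, map_smul]
      conv_lhs => rw [h]
      have h1 : centralDiff (centralFactorial 0) = 0 := by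
        refine Polynomial.funext fun x => ?_
        simp [eval_centralDiff, centralFactorial]
      rw [h1, smul_zero, add_zero]
      refine Finset.sum_congr rfl fun n _ => ?_
      rw [map_smul, centralDiff_centralFactorial_succ, smul_smul, Function.iterate_succ_apply,
        Nat.factorial_succ]
      have : (n.factorial : ℝ) ≠ 0 := by positivity
      have : (n : ℝ) + 1 ≠ 0 := by positivity
      congr 1
      push_cast
      field_simp
    · simp [eval_finsetSum, centralFactorial]

/-- Newton's formula for the translate of P by y, read off at the coefficient of degree k, is the
expansion of D^k at the point y. -/
theorem iterate_derivative_eq_sum_centralDiff (k : ℕ) {N : ℕ} {P : ℝ[X]} (hP : P.degree < N) :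
    derivative^[k] P = ∑ n ∈ Finset.range N,
      ((k.factorial : ℝ) * (centralFactorial n).coeff k / n.factorial) • centralDiff^[n] P := by
  refine Polynomial.funext fun y => ?_
  have h := congrArg (fun Q : ℝ[X] => Q.coeff k)
    (newton_centralDiff N (P := taylor y P) (by rwa [degree_taylor]))
  simp only [iterate_centralDiff_taylor, taylor_eval, zero_add, finsetSum_coeff, coeff_smul,
    taylor_coeff, smul_eq_mul] at h
  rw [← factorial_smul_hasseDeriv, LinearMap.smul_apply, eval_smul, nsmul_eq_mul, h,
    eval_finsetSum, Finset.mul_sum]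
  refine Finset.sum_congr rfl fun n _ => ?_
  rw [eval_smul, smul_eq_mul]
  ring

/-- The coefficients of the expansion of `(t / (2 sinh (t/2)))^(p+1)` in powers of
`(2 sinh (t/2))^2`. -/
def diffCoeff (p l : ℕ) : ℝ :=
  ((p + 1).factorial : ℝ) / ((2 * l + p + 1).factorial : ℝ)
    * centralFactorialNumber (2 * l + p + 1) (p + 1)

theorem sum_range_succ_eq_sum_even {E : Type*} [AddCommMonoid E] (p : ℕ) (g : ℕ → E)
    (hg : ∀ i, Odd i → g i = 0) :
    ∑ i ∈ Finset.range (p + 1), g i = ∑ l ∈ Finset.range (p / 2 + 1), g (2 * l) := by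
  rw [← Finset.sum_image (f := g) (g := fun l => 2 * l) fun _ _ _ _ h =>
    Nat.eq_of_mul_eq_mul_left two_pos h]
  refine (Finset.sum_subset (fun i hi => ?_) fun i hi hi' => hg i ?_).symm
  · simp only [Finset.mem_image, Finset.mem_range] at hi ⊢
    omega
  · by_contra hodd
    obtain ⟨l, rfl⟩ := even_iff_two_dvd.1 (Nat.not_odd_iff_even.1 hodd)
    refine hi' (Finset.mem_image_of_mem _ ?_)
    simp only [Finset.mem_range] at hi ⊢
    omega

/-- Expand D^{p+1}F in powers of δ for an F with D^{p+1}F = `knotPoly p` and δ^{p+1}F = x^p. -/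
theorem sum_centralDiff_X_pow (p : ℕ) :
    ∑ l ∈ Finset.range (p / 2 + 1), diffCoeff p l • centralDiff^[2 * l] (X ^ p) = knotPoly p := by
  -- A (p+1)-fold antiderivative of x^p, from which F is obtained by applying M⁻¹ to the power p+1.
  set Y : ℝ[X] := ((p.factorial : ℝ) / (2 * p + 1).factorial) • X ^ (2 * p + 1)
  have hY : derivative^[p + 1] Y = X ^ p := by
    rw [iterate_derivative_smul, iterate_derivative_X_pow_eq_smul, smul_smul,
      show 2 * p + 1 - (p + 1) = p by omega]
    convert one_smul ℝ (X ^ p : ℝ[X]) using 2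
    have h := Nat.factorial_mul_descFactorial (show p + 1 ≤ 2 * p + 1 by omega)
    rw [show 2 * p + 1 - (p + 1) = p by omega] at h
    have : ((2 * p + 1).factorial : ℝ) ≠ 0 := by positivity
    rw [← h]; rw [← h] at this
    push_cast at this ⊢
    rw [div_mul_eq_mul_div, div_self this]
  set F := act (meanSeries⁻¹ ^ (p + 1)) Y
  have hF1 : derivative^[p + 1] F = knotPoly p := by
    rw [← act_X_pow, ← act_mul, mul_comm, act_mul, act_X_pow, hY, knotPoly_eq_act]
  have hF2 : centralDiff^[p + 1] F = X ^ p := by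
    rw [iterate_centralDiff_eq_act, ← act_mul, mul_pow, mul_assoc, ← mul_pow, meanSeries_mul_inv,
      one_pow, mul_one, act_X_pow, hY]
  have hdeg : F.degree < (2 * p + 2 : ℕ) := by
    have h1 : F.natDegree ≤ 2 * p + 1 :=
      (natDegree_act_le _ _).trans ((natDegree_smul_le _ _).trans (natDegree_X_pow_le _))
    exact (natDegree_le_iff_degree_le.1 h1).trans_lt (by exact_mod_cast Nat.lt_succ_self _)
  have h := iterate_derivative_eq_sum_centralDiff (p + 1) hdeg
  rw [hF1] at h
  have h0 : ∀ n ∈ Finset.range (p + 1), ((p + 1).factorial * (centralFactorial n).coeff (p + 1) /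
      n.factorial : ℝ) • centralDiff^[n] F = 0 := by
    intro n hn
    have : (centralFactorial n).coeff (p + 1) = 0 := by
      cases n with
      | zero => simp [centralFactorial, coeff_one]
      | succ n =>
        rw [centralFactorial, coeff_X_mul]
        refine coeff_eq_zero_of_natDegree_lt ?_
        rw [natDegree_knotPoly]
        have := Finset.mem_range.1 hn
        omega
    rw [this, mul_zero, zero_div, zero_smul]
  symm
  rw [h, show 2 * p + 2 = (p + 1) + (p + 1) by ring, Finset.sum_range_add, Finset.sum_eq_zero h0,
    zero_add, sum_range_succ_eq_sum_even]
  · refine Finset.sum_congr rfl fun l _ => ?_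
    rw [add_comm (p + 1), Function.iterate_add_apply, hF2, diffCoeff, centralFactorialNumber,
      ← add_assoc, centralFactorialPoly_succ, centralFactorial, mul_div_right_comm]
  -- Odd differences drop out by the parity of `knotPoly`.
  · intro i hi
    rw [show p + 1 + i = (p + i) + 1 by ring, centralFactorial, coeff_X_mul,
      coeff_knotPoly_eq_zero, mul_zero, zero_div, zero_smul]
    rw [show p + i + p = 2 * p + i by ring]
    exact (even_two_mul p).add_odd hi

theorem eval_iterate_centralDiff (n : ℕ) (P : ℝ[X]) (x : ℝ) :
    (centralDiff^[n] P).eval x = (fwdDiff (1 : ℝ))^[n] (fun t => P.eval t) (x - n / 2) := by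
  induction n generalizing x with
  | zero => simp
  | succ n ih =>
    rw [Function.iterate_succ_apply', Function.iterate_succ_apply', eval_centralDiff, ih, ih,
      fwdDiff]
    push_cast
    ring_nf

/-- Binomial expansion with r = l - k; the range is widened to a common q because the extra
binomials vanish. -/
theorem eval_iterate_centralDiff_two_mul {l q : ℕ} (h : l ≤ q) (P : ℝ[X]) (x : ℝ) :
    (centralDiff^[2 * l] P).eval x = ∑ r ∈ Finset.Icc (-(q : ℤ)) q,
      (-1 : ℝ) ^ (l + r.natAbs) * ((2 * l).choose (l + r.natAbs) : ℝ) * P.eval (x - r) := by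
  rw [eval_iterate_centralDiff, fwdDiff_iter_eq_sum_shift]
  have hinj : Set.InjOn (fun k : ℕ => (l : ℤ) - k) (Finset.range (2 * l + 1)) :=
    fun a _ b _ hab => by simpa using hab
  rw [← Finset.sum_subset (s₁ := (Finset.range (2 * l + 1)).image fun k : ℕ => (l : ℤ) - k),
    Finset.sum_image hinj]
  · refine Finset.sum_congr rfl fun k hk => ?_
    rw [Finset.mem_range] at hk
    have hx : x - ((2 * l : ℕ) : ℝ) / 2 + k • (1 : ℝ) = x - (((l : ℤ) - (k : ℤ) : ℤ) : ℝ) := by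
      push_cast
      rw [nsmul_eq_mul]
      ring
    rw [hx, zsmul_eq_mul]
    push_cast
    congr 1
    rcases le_or_gt k l with hkl | hkl
    · rw [show l + ((l : ℤ) - k).natAbs = 2 * l - k by omega, Nat.choose_symm (by omega)]
    · rw [show l + ((l : ℤ) - k).natAbs = k by omega]
      congr 1
      have h1 : 2 * (k - l) + (2 * l - k) = k := by omega
      have h2 := pow_add (-1 : ℝ) (2 * (k - l)) (2 * l - k)
      rw [h1, (even_two_mul (k - l)).neg_one_pow, one_mul] at h2
      rw [h2]
  · intro r hr
    simp only [Finset.mem_image, Finset.mem_range, Finset.mem_Icc] at hr ⊢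
    obtain ⟨k, hk, rfl⟩ := hr
    omega
  · intro r _ hr
    rw [Nat.choose_eq_zero_of_lt, Nat.cast_zero, mul_zero, zero_mul]
    by_contra hlt
    refine hr (Finset.mem_image.2 ⟨((l : ℤ) - r).toNat, Finset.mem_range.2 (by omega), by omega⟩)

theorem coeffC_eq_sum (p : ℕ) (j : ℤ) :
    coeffC p j = ∑ l ∈ Finset.range (p / 2 + 1),
      (-1 : ℝ) ^ (l + j.natAbs) * ((2 * l).choose (l + j.natAbs) : ℝ) * diffCoeff p l := by
  refine Finset.sum_subset (fun l hl => ?_) fun l hl hl' => ?_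
  · simp only [Finset.mem_Icc, Finset.mem_range] at hl ⊢
    omega
  · simp only [Finset.mem_Icc, Finset.mem_range] at hl hl'
    rw [Nat.choose_eq_zero_of_lt (by omega), Nat.cast_zero, mul_zero, zero_mul]

theorem coeffC_neg (p : ℕ) (j : ℤ) : coeffC p (-j) = coeffC p j := by
  rw [coeffC, coeffC, Int.natAbs_neg]

theorem coeffC_eq_zero {p : ℕ} {j : ℤ} (h : p / 2 < j.natAbs) : coeffC p j = 0 := by
  rw [coeffC, Finset.Icc_eq_empty (by omega), Finset.sum_empty]

/-- By Marsden's identity this expresses that the quasi-interpolant reproduces x ↦ (y-x)^p for every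
y. -/
theorem sum_coeffC_mul_pow (p : ℕ) (z : ℝ) :
    ∑ r ∈ Finset.Icc (-((p / 2 : ℕ) : ℤ)) (p / 2 : ℕ), coeffC p r * (z - r) ^ p =
      (knotPoly p).eval z := by
  rw [← sum_centralDiff_X_pow, eval_finsetSum]
  simp only [coeffC_eq_sum, Finset.sum_mul]
  rw [Finset.sum_comm]
  refine Finset.sum_congr rfl fun l hl => ?_
  rw [eval_smul, smul_eq_mul, eval_iterate_centralDiff_two_mul
    (Nat.lt_succ_iff.1 (Finset.mem_range.1 hl)), Finset.mul_sum]
  refine Finset.sum_congr rfl fun r _ => ?_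
  rw [eval_pow, eval_X]
  ring

/-! ### B-splines -/

theorem bspline_succ (m : ℕ) (x : ℝ) : bspline (m + 1) x =
    ((x + ((m : ℝ) + 2) / 2) * bspline m (x + 1 / 2)
      + (((m : ℝ) + 2) / 2 - x) * bspline m (x - 1 / 2)) / ((m : ℝ) + 1) := rfl

theorem bspline_eq_zero {m : ℕ} {x : ℝ} (h : x < -(((m : ℝ) + 1) / 2) ∨ ((m : ℝ) + 1) / 2 ≤ x) :
    bspline m x = 0 := by
  induction m generalizing x with
  | zero =>
    rw [bspline, if_neg]
    rintro ⟨h1, h2⟩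
    norm_num at h
    rcases h with h | h <;> linarith
  | succ m ih =>
    push_cast at h
    rw [bspline_succ, ih, ih, mul_zero, mul_zero, add_zero, zero_div]
    · rcases h with h | h
      · left; linarith
      · right; linarith
    · rcases h with h | h
      · left; linarith
      · right; linarith

/-- Evenness starts in degree 1: in degree 0 the half-open interval breaks it at the endpoints. -/
theorem bspline_succ_neg (m : ℕ) (x : ℝ) : bspline (m + 1) (-x) = bspline (m + 1) x := by
  induction m generalizing x with
  | zero =>
    rw [bspline_succ, bspline_succ]
    simp only [bspline]
    split_ifs with h1 h2 h3 h4 h5 h6 h7 <;> norm_num <;> grind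
  | succ m ih =>
    rw [bspline_succ, bspline_succ _ x, show -x + 1 / 2 = -(x - 1 / 2) by ring,
      show -x - 1 / 2 = -(x + 1 / 2) by ring, ih, ih]
    ring

theorem bspline_succ_eq_zero {m : ℕ} {x : ℝ} (h : ((m : ℝ) + 2) / 2 ≤ |x|) :
    bspline (m + 1) x = 0 := by
  have h1 : bspline (m + 1) |x| = 0 := bspline_eq_zero (Or.inr (by push_cast; linarith))
  rcases abs_choice x with hx | hx <;> rw [hx] at h1
  · exact h1
  · rwa [bspline_succ_neg] at h1

theorem summable_mul_bspline (m : ℕ) (x : ℝ) (g : ℤ → ℝ) :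
    Summable fun n : ℤ => g n * bspline m (x - n) := by
  refine summable_of_ne_finset_zero
    (s := Finset.Icc ⌊x - ((m : ℝ) + 1) / 2⌋ ⌈x + ((m : ℝ) + 1) / 2⌉) fun n hn => ?_
  rw [bspline_eq_zero, mul_zero]
  by_contra! h
  refine hn (Finset.mem_Icc.2 ⟨?_, ?_⟩)
  · exact Int.floor_le_iff.2 (by linarith)
  · exact Int.cast_le.1 ((by linarith : (n : ℝ) ≤ x + ((m : ℝ) + 1) / 2).trans (Int.le_ceil _))

/-- **Marsden's identity** for the cardinal B-splines. -/
theorem hasSum_knotPoly_mul_bspline (m : ℕ) (x y : ℝ) :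
    HasSum (fun n : ℤ => (knotPoly m).eval (y - n) * bspline m (x - n)) ((y - x) ^ m) := by
  induction m generalizing x y with
  | zero =>
    have h1 : ∀ n : ℤ, n ≠ ⌊x + 1 / 2⌋ →
        (knotPoly 0).eval (y - n) * bspline 0 (x - n) = 0 := by
      intro n hn
      rw [bspline, if_neg, mul_zero]
      rintro ⟨h1, h2⟩
      exact hn (Int.floor_eq_iff.2 ⟨by linarith, by linarith⟩).symm
    convert hasSum_single _ h1 using 1
    rw [bspline, if_pos]
    · simp [knotPoly_zero]
    · exact ⟨by linarith [Int.floor_le (x + 1 / 2)], by linarith [Int.lt_floor_add_one (x + 1 / 2)]⟩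
  | succ m ih =>
    -- A and B carry the two terms of the recursion; B is shifted by one index so that both multiply
    -- the same values of `bspline m`.
    set A : ℤ → ℝ := fun n => (knotPoly (m + 1)).eval (y - n) * (x - n + ((m : ℝ) + 2) / 2)
    set B : ℤ → ℝ := fun n => (knotPoly (m + 1)).eval (y - n + 1) * (((m : ℝ) + 2) / 2 - x + n - 1)
    have hA := (summable_mul_bspline m (x + 1 / 2) A).hasSum
    have hB := (summable_mul_bspline m (x + 1 / 2) B).hasSum
    have hB' := (Equiv.hasSum_iff (Equiv.addRight (1 : ℤ))).2 hB
    -- Both coefficients contain `knotPoly m`, and the remaining linear factors combine to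
    -- (m+1)(y-x), independent of n.
    have hAB : ∀ n : ℤ, ((m : ℝ) + 1) * (y - x) *
        ((knotPoly m).eval (y + 1 / 2 - n) * bspline m (x + 1 / 2 - n)) =
        A n * bspline m (x + 1 / 2 - n) + B n * bspline m (x + 1 / 2 - n) := by
      intro n
      have h1 := eval_knotPoly_succ_add m (y + 1 / 2 - n)
      have h2 := eval_knotPoly_succ_sub m (y + 1 / 2 - n)
      rw [show y + 1 / 2 - (n : ℝ) + 1 / 2 = y - n + 1 by ring] at h1
      rw [show y + 1 / 2 - (n : ℝ) - 1 / 2 = y - n by ring] at h2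
      simp only [A, B, h1, h2]
      ring
    have h := (ih (x + 1 / 2) (y + 1 / 2)).mul_left (((m : ℝ) + 1) * (y - x))
    simp only [hAB] at h
    replace h := h.unique (hA.add hB)
    have key := (hA.add hB').mul_right ((m : ℝ) + 1)⁻¹
    have hm : (m : ℝ) + 1 ≠ 0 := by positivity
    have hv : ((m : ℝ) + 1) * (y - x) * (y + 1 / 2 - (x + 1 / 2)) ^ m * ((m : ℝ) + 1)⁻¹ =
        (y - x) ^ (m + 1) := by
      rw [add_sub_add_right_eq_sub]
      field_simp
      ring
    rw [← h, hv] at key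
    refine Eq.mp (congrArg (fun g => HasSum g ((y - x) ^ (m + 1))) (funext fun n => ?_)) key
    simp only [Function.comp_apply, Equiv.coe_addRight, A, B, bspline_succ]
    push_cast
    rw [show x + 1 / 2 - ((n : ℝ) + 1) = x - n - 1 / 2 by ring,
      show y - ((n : ℝ) + 1) + 1 = y - n by ring, show x + 1 / 2 - (n : ℝ) = x - n + 1 / 2 by ring]
    ring

/-- The two index ranges differ only where `coeffC` vanishes or, as p ≤ 2q+1, where the argument
leaves the support of the spline. -/
theorem tau_eq_sum (p : ℕ) (j : ℤ) :
    tau p j = ∑ r ∈ Finset.Icc (-((p / 2 : ℕ) : ℤ)) (p / 2 : ℕ),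
      coeffC p r * bspline (p + 1) ((r : ℝ) - (j : ℝ) + 1 / 2) := by
  refine Finset.sum_congr_of_eq_on_inter (fun r _ hr => ?_) (fun r _ hr => ?_) fun _ _ _ => rfl
  · rw [coeffC_eq_zero, zero_mul]
    simp only [Finset.mem_Icc] at hr
    omega
  · rw [bspline_succ_eq_zero, mul_zero]
    simp only [Finset.mem_Icc, not_and_or, not_le] at hr
    rw [le_abs]
    obtain ⟨q, hq⟩ : ∃ q, q = p / 2 := ⟨_, rfl⟩
    rw [← hq] at hr
    have hp : (p : ℝ) ≤ 2 * q + 1 := by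
      norm_cast; omega
    rcases hr with hr | hr
    · right
      have := (Int.cast_le (R := ℝ)).2 (Int.add_one_le_of_lt hr)
      push_cast at this ⊢
      linarith
    · left
      have := (Int.cast_le (R := ℝ)).2 (Int.add_one_le_of_lt hr)
      push_cast at this ⊢
      linarith

theorem tau_one_sub (p : ℕ) (j : ℤ) : tau p (1 - j) = tau p j := by
  rw [tau_eq_sum, tau_eq_sum]
  refine Finset.sum_nbij' (fun r => -r) (fun r => -r) ?_ ?_ ?_ ?_ ?_
  · intro r hr; simp only [Finset.mem_Icc] at hr ⊢; omega
  · intro r hr; simp only [Finset.mem_Icc] at hr ⊢; omega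
  · intro r _; ring
  · intro r _; ring
  · intro r _
    rw [coeffC_neg, ← bspline_succ_neg]
    push_cast
    ring_nf

/-- Marsden's identity of degree p+1 at x = r + 1/2, for each r; the finite range of j contains
every spline that can be nonzero there. -/
theorem sum_tau_mul_knotPoly (p : ℕ) (y : ℝ) :
    ∑ j ∈ Finset.Icc (-(2 * ((p / 2 : ℕ) : ℤ))) (2 * ((p / 2 : ℕ) : ℤ) + 1),
      tau p j * (knotPoly (p + 1)).eval (y - j) =
    ∑ r ∈ Finset.Icc (-((p / 2 : ℕ) : ℤ)) (p / 2 : ℕ), coeffC p r * (y - 1 / 2 - r) ^ (p + 1) := by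
  simp only [tau_eq_sum, Finset.sum_mul]
  rw [Finset.sum_comm]
  refine Finset.sum_congr rfl fun r hr => ?_
  have h := hasSum_knotPoly_mul_bspline (p + 1) ((r : ℝ) + 1 / 2) y
  rw [show y - 1 / 2 - (r : ℝ) = y - (r + 1 / 2) by ring, h.unique (hasSum_sum_of_ne_finset_zero
    (s := Finset.Icc (-(2 * ((p / 2 : ℕ) : ℤ))) (2 * ((p / 2 : ℕ) : ℤ) + 1)) fun j hj => ?_),
    Finset.mul_sum]
  · refine Finset.sum_congr rfl fun j _ => ?_
    rw [show (r : ℝ) - j + 1 / 2 = r + 1 / 2 - j by ring]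
    ring
  · rw [bspline_succ_eq_zero, mul_zero]
    simp only [Finset.mem_Icc, not_and_or, not_le] at hr hj
    rw [le_abs]
    obtain ⟨q, hq⟩ : ∃ q, q = p / 2 := ⟨_, rfl⟩
    rw [← hq] at hr hj
    have hp : (p : ℝ) ≤ 2 * q + 1 := by
      norm_cast; omega
    have h1 := (Int.cast_le (R := ℝ)).2 hr.1
    have h2 := (Int.cast_le (R := ℝ)).2 hr.2
    rcases hj with hj | hj
    · left
      have := (Int.cast_le (R := ℝ)).2 (Int.add_one_le_of_lt hj)
      push_cast at this h1 h2 ⊢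
      linarith
    · right
      have := (Int.cast_le (R := ℝ)).2 (Int.add_one_le_of_lt hj)
      push_cast at this h1 h2 ⊢
      linarith

/-! ### Exactness of the local quadrature rule -/

/-- The window of indices `-2⌊p/2⌋, …, 2⌊p/2⌋ + 1` carrying the weights `τ_{p,j}`. -/
def window (p : ℕ) : Finset ℤ :=
  Finset.Icc (-(2 * ((p / 2 : ℕ) : ℤ))) (2 * ((p / 2 : ℕ) : ℤ) + 1)

/-- The error on polynomials of the quadrature rule with weights `τ_{p,j}` for the unit interval. -/
def localDefect (p : ℕ) : ℝ[X] →ₗ[ℝ] ℝ where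
  toFun P := ∑ j ∈ window p, tau p j * P.eval (j : ℝ) - ∫ x in (0 : ℝ)..1, P.eval x
  map_add' P Q := by
    simp only [eval_add, mul_add, Finset.sum_add_distrib]
    rw [intervalIntegral.integral_add (P.continuous.intervalIntegrable _ _)
      (Q.continuous.intervalIntegrable _ _)]
    ring
  map_smul' c P := by
    simp only [eval_smul, smul_eq_mul, RingHom.id_apply, intervalIntegral.integral_const_mul,
      mul_sub, Finset.mul_sum]
    congr 1
    exact Finset.sum_congr rfl fun j _ => by ring

theorem localDefect_apply (p : ℕ) (P : ℝ[X]) : localDefect p P =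
    ∑ j ∈ window p, tau p j * P.eval (j : ℝ) - ∫ x in (0 : ℝ)..1, P.eval x := rfl

/-- The weighted sum and the integral, multiplied by p+1, both equal ∑_r c_{p,r} ((z-r)^{p+1} -
(z-1-r)^{p+1}): the first by differencing `sum_tau_mul_knotPoly` in y, the second by integrating
`sum_coeffC_mul_pow`. -/
theorem localDefect_knotPoly_comp_self (p : ℕ) (z : ℝ) :
    localDefect p ((knotPoly p).comp (C z - X)) = 0 := by
  have hp : (p : ℝ) + 1 ≠ 0 := by positivity
  simp only [localDefect_apply, eval_comp, eval_sub, eval_C, eval_X]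
  rw [sub_eq_zero, intervalIntegral.integral_comp_sub_left (fun x => (knotPoly p).eval x), sub_zero]
  simp only [← sum_coeffC_mul_pow]
  rw [intervalIntegral.integral_finsetSum fun r _ =>
    Continuous.intervalIntegrable (by fun_prop) _ _]
  simp only [sum_coeffC_mul_pow, intervalIntegral.integral_const_mul,
    intervalIntegral.integral_comp_sub_right (fun x => x ^ p), integral_pow]
  refine mul_left_cancel₀ hp ?_
  have h1 := sum_tau_mul_knotPoly p (z + 1 / 2)
  have h2 := sum_tau_mul_knotPoly p (z - 1 / 2)
  calc ((p : ℝ) + 1) * ∑ j ∈ window p, tau p j * (knotPoly p).eval (z - j)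
      = ∑ j ∈ window p, tau p j * (knotPoly (p + 1)).eval (z + 1 / 2 - j)
        - ∑ j ∈ window p, tau p j * (knotPoly (p + 1)).eval (z - 1 / 2 - j) := by
        rw [Finset.mul_sum, ← Finset.sum_sub_distrib]
        refine Finset.sum_congr rfl fun j _ => ?_
        have h3 := eval_centralDiff (knotPoly (p + 1)) (z - j)
        rw [centralDiff_knotPoly_succ, eval_smul, smul_eq_mul] at h3
        rw [show z + 1 / 2 - (j : ℝ) = z - j + 1 / 2 by ring,
          show z - 1 / 2 - (j : ℝ) = z - j - 1 / 2 by ring, ← mul_sub, ← h3]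
        ring
    _ = _ := by
        rw [window, h1, h2, ← Finset.sum_sub_distrib, Finset.mul_sum]
        refine Finset.sum_congr rfl fun r _ => ?_
        field_simp
        ring

/-- The vanishing holds for all z, so a central difference in z lowers the degree by one. -/
theorem localDefect_knotPoly_comp (p i : ℕ) (hi : i ≤ p) (z : ℝ) :
    localDefect p ((knotPoly (p - i)).comp (C z - X)) = 0 := by
  induction i generalizing z with
  | zero => exact localDefect_knotPoly_comp_self p z
  | succ i ih =>
    obtain ⟨k, hk⟩ : ∃ k, p = k + (i + 1) := ⟨p - (i + 1), by omega⟩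
    have h1 := ih (by omega) (z + 1 / 2)
    have h2 := ih (by omega) (z - 1 / 2)
    rw [show p - i = k + 1 by omega] at h1 h2
    rw [show p - (i + 1) = k by omega]
    have h3 : ((k : ℝ) + 1) • (knotPoly k).comp (C z - X) =
        (knotPoly (k + 1)).comp (C (z + 1 / 2) - X)
          - (knotPoly (k + 1)).comp (C (z - 1 / 2) - X) := by
      refine Polynomial.funext fun x => ?_
      have h4 := eval_centralDiff (knotPoly (k + 1)) (z - x)
      rw [centralDiff_knotPoly_succ, eval_smul, smul_eq_mul] at h4
      simp only [eval_smul, eval_sub, eval_comp, eval_C, eval_X, smul_eq_mul, h4]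
      ring_nf
    have h5 := congrArg (localDefect p) h3
    rw [map_sub, h1, h2, sub_zero, map_smul, smul_eq_mul] at h5
    exact (mul_eq_zero.1 h5).resolve_left (by positivity)

theorem localDefect_knotPoly {p n : ℕ} (hn : n ≤ p) : localDefect p (knotPoly n) = 0 := by
  have h := localDefect_knotPoly_comp p (p - n) (Nat.sub_le _ _) 0
  rw [Nat.sub_sub_self hn] at h
  have h1 : (knotPoly n).comp (C 0 - X) = (-1 : ℝ) ^ n • knotPoly n :=
    Polynomial.funext fun x => by simp [eval_knotPoly_neg]
  rw [h1, map_smul, smul_eq_mul] at h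
  exact (mul_eq_zero.1 h).resolve_left (by positivity)

theorem degree_sub_coeff_smul_lt {n : ℕ} {P Q : ℝ[X]} (hP : P.degree < (n + 1 : ℕ))
    (hQ : Q.Monic) (hQn : Q.natDegree = n) : (P - P.coeff n • Q).degree < n := by
  rw [degree_lt_iff_coeff_zero] at hP ⊢
  intro m hm
  rw [coeff_sub, coeff_smul, smul_eq_mul]
  rcases hm.eq_or_lt with rfl | hm
  · rw [show Q.coeff n = 1 by rw [← hQn]; exact hQ, mul_one, sub_self]
  · rw [hP m hm, coeff_eq_zero_of_natDegree_lt (hQn.trans_lt hm), mul_zero, sub_zero]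

theorem localDefect_eq_zero_of_degree_lt {p n : ℕ} (hn : n ≤ p + 1) {P : ℝ[X]}
    (hP : P.degree < n) : localDefect p P = 0 := by
  induction n generalizing P with
  | zero =>
    have : P = 0 := by
      rw [← degree_eq_bot]
      simpa using hP
    rw [this, map_zero]
  | succ n ih =>
    have h := ih (by omega) (degree_sub_coeff_smul_lt hP (monic_knotPoly n) (natDegree_knotPoly n))
    rwa [map_sub, map_smul, localDefect_knotPoly (by omega), smul_zero, sub_zero] at h

theorem localDefect_comp_one_sub (p : ℕ) (P : ℝ[X]) :
    localDefect p (P.comp (1 - X)) = localDefect p P := by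
  simp only [localDefect_apply, eval_comp, eval_sub, eval_one, eval_X]
  rw [intervalIntegral.integral_comp_sub_left (fun x => P.eval x), sub_self, sub_zero]
  congr 1
  refine Finset.sum_nbij' (fun r => 1 - r) (fun r => 1 - r) ?_ ?_ ?_ ?_ ?_
  · intro r hr; simp only [window, Finset.mem_Icc] at hr ⊢; omega
  · intro r hr; simp only [window, Finset.mem_Icc] at hr ⊢; omega
  · intro r _; ring
  · intro r _; ring
  · intro r _
    rw [tau_one_sub]
    push_cast
    rfl

/-- For odd p the bound is degree ≤ p. For even p the extra degree comes from (x-1/2)^{p+1}, which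
is odd under the reflection x ↦ 1-x that preserves the defect. -/
theorem localDefect_eq_zero (p : ℕ) {P : ℝ[X]} (hP : P.degree < (2 * (p / 2) + 2 : ℕ)) :
    localDefect p P = 0 := by
  rcases Nat.even_or_odd p with hp | hp
  · rw [Nat.two_mul_div_two_of_even hp] at hP
    have hQ : ((X - C (1 / 2 : ℝ)) ^ (p + 1)).natDegree = p + 1 := by
      rw [natDegree_pow, natDegree_X_sub_C, mul_one]
    have h := localDefect_eq_zero_of_degree_lt le_rfl
      (degree_sub_coeff_smul_lt hP ((monic_X_sub_C (1 / 2 : ℝ)).pow (p + 1)) hQ)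
    have h1 : ((X - C (1 / 2 : ℝ)) ^ (p + 1)).comp (1 - X) =
        (-1 : ℝ) • (X - C (1 / 2 : ℝ)) ^ (p + 1) := by
      refine Polynomial.funext fun x => ?_
      simp only [eval_comp, eval_pow, eval_sub, eval_X, eval_C, eval_one, eval_smul, smul_eq_mul]
      rw [show 1 - x - 1 / 2 = -(x - 1 / 2) by ring, hp.add_one.neg_pow]
      ring
    have h2 := localDefect_comp_one_sub p ((X - C (1 / 2 : ℝ)) ^ (p + 1))
    rw [h1, map_smul, smul_eq_mul] at h2
    have h3 : localDefect p ((X - C (1 / 2 : ℝ)) ^ (p + 1)) = 0 := by linarith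
    rwa [map_sub, map_smul, h3, smul_zero, sub_zero] at h
  · refine localDefect_eq_zero_of_degree_lt le_rfl (hP.trans_eq ?_)
    obtain ⟨k, rfl⟩ := hp
    congr 1
    omega

theorem sum_tau (p : ℕ) : ∑ j ∈ window p, tau p j = 1 := by
  have h := localDefect_eq_zero p (P := 1) (by
    rw [degree_one]; exact_mod_cast Nat.succ_pos _)
  simpa [localDefect_apply, sub_eq_zero] using h

/-! ### The corrected trapezoidal rule as a composite rule -/

theorem sum_Icc_neg_eq_sum_range (m : ℕ) (g : ℤ → ℝ) :
    ∑ j ∈ Finset.Icc (-(m : ℤ)) ((m : ℤ) + 1), g j =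
      ∑ i ∈ Finset.range (m + 1), (g (-(i : ℤ)) + g (1 + (i : ℤ))) := by
  induction m with
  | zero =>
    rw [show Finset.Icc (-((0 : ℕ) : ℤ)) (((0 : ℕ) : ℤ) + 1) = {0, 1} by rfl]
    simp
  | succ m ih =>
    have h : Finset.Icc (-((m + 1 : ℕ) : ℤ)) (((m + 1 : ℕ) : ℤ) + 1) =
        insert (-((m + 1 : ℕ) : ℤ)) (insert (1 + ((m + 1 : ℕ) : ℤ))
          (Finset.Icc (-(m : ℤ)) ((m : ℤ) + 1))) := by
      ext j
      simp only [Finset.mem_insert, Finset.mem_Icc]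
      omega
    rw [h, Finset.sum_insert, Finset.sum_insert, ih, Finset.sum_range_succ _ (m + 1)]
    · ring
    · simp only [Finset.mem_Icc]; omega
    · simp only [Finset.mem_insert, Finset.mem_Icc]; omega

theorem sum_sub_succ_mul (x g : ℕ → ℝ) (n : ℕ) :
    ∑ i ∈ Finset.range (n + 1), (x i - x (i + 1)) * g i =
      x 0 * g 0 + ∑ i ∈ Finset.Icc 1 n, x i * (g i - g (i - 1)) - x (n + 1) * g n := by
  induction n with
  | zero => simp; ring
  | succ n ih =>
    rw [Finset.sum_range_succ, ih, Finset.sum_Icc_succ_top (by omega), Nat.add_sub_cancel]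
    ring

theorem xi_neg_sub_xi_neg_succ (p i : ℕ) (hi : i ≤ 2 * (p / 2)) :
    xi p (-(i : ℤ)) - xi p (-((i + 1 : ℕ) : ℤ)) = tau p (-(i : ℤ)) := by
  have h : Finset.Icc (-(2 * ((p / 2 : ℕ) : ℤ))) (-(i : ℤ)) =
      insert (-(i : ℤ)) (Finset.Icc (-(2 * ((p / 2 : ℕ) : ℤ))) (-((i + 1 : ℕ) : ℤ))) := by
    ext j
    simp only [Finset.mem_insert, Finset.mem_Icc]
    omega
  rw [xi, xi, h, Finset.sum_insert, add_sub_cancel_right]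
  simp only [Finset.mem_Icc]
  omega

theorem xi_eq_zero (p : ℕ) : xi p (-((2 * (p / 2) + 1 : ℕ) : ℤ)) = 0 := by
  rw [xi, Finset.Icc_eq_empty (by omega), Finset.sum_empty]

/-- Pair j = -i with j = 1+i, which carry equal weights, then sum by parts, τ being the difference
of ξ. -/
theorem sum_window_tau_mul (p : ℕ) (g : ℤ → ℝ) :
    ∑ j ∈ window p, tau p j * g j =
      xi p 0 * (g 0 + g 1) + ∑ i ∈ Finset.Icc 1 (2 * (p / 2)),
        xi p (-(i : ℤ)) * (g (-(i : ℤ)) + g (1 + (i : ℤ)) - g (1 - (i : ℤ)) - g (i : ℤ)) := by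
  have h1 := sum_Icc_neg_eq_sum_range (2 * (p / 2)) fun j => tau p j * g j
  have h2 := sum_sub_succ_mul (fun i : ℕ => xi p (-(i : ℤ)))
    (fun i : ℕ => g (-(i : ℤ)) + g (1 + (i : ℤ))) (2 * (p / 2))
  rw [xi_eq_zero] at h2
  have h0 : window p =
      Finset.Icc (-((2 * (p / 2) : ℕ) : ℤ)) (((2 * (p / 2) : ℕ) : ℤ) + 1) := by
    rw [window]; push_cast; rfl
  rw [h0, h1]
  trans ∑ i ∈ Finset.range (2 * (p / 2) + 1),
    (xi p (-(i : ℤ)) - xi p (-((i + 1 : ℕ) : ℤ))) * (g (-(i : ℤ)) + g (1 + (i : ℤ)))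
  · refine Finset.sum_congr rfl fun i hi => ?_
    rw [xi_neg_sub_xi_neg_succ p i (Nat.lt_succ_iff.1 (Finset.mem_range.1 hi)),
      show (1 + (i : ℤ)) = 1 - (-(i : ℤ)) by ring, tau_one_sub]
    ring
  · rw [h2, zero_mul, sub_zero]
    simp only [Nat.cast_zero, neg_zero, add_zero]
    congr 1
    refine Finset.sum_congr rfl fun i hi => ?_
    rw [Finset.mem_Icc] at hi
    rw [Nat.cast_sub hi.1, Nat.cast_one, neg_sub, add_sub_cancel]
    ring

/-- Exactness on constants; this is what makes the leading part the trapezoidal rule. -/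
theorem xi_zero (p : ℕ) : xi p 0 = 1 / 2 := by
  have h := sum_window_tau_mul p fun _ => 1
  simp only [mul_one, sum_tau] at h
  norm_num at h
  linarith

/-- Each panel's correction is exactly the change of the end correction when N grows by one; at N =
0 the two ends cancel. -/
theorem sum_sum_tau_mul (p N : ℕ) (g : ℤ → ℝ) :
    ∑ k ∈ Finset.range N, ∑ j ∈ window p, tau p j * g ((k : ℤ) + j) =
      ∑ k ∈ Finset.range N, (g (k : ℤ) + g ((k : ℤ) + 1)) / 2
        + ∑ i ∈ Finset.Icc 1 (2 * (p / 2)), xi p (-(i : ℤ))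
          * (g (-(i : ℤ)) - g (i : ℤ) + g ((N : ℤ) + (i : ℤ)) - g ((N : ℤ) - (i : ℤ))) := by
  induction N with
  | zero =>
    simp only [Finset.range_zero, Finset.sum_empty, Nat.cast_zero, zero_add, zero_sub]
    rw [Finset.sum_eq_zero]
    intro i _
    ring
  | succ N ih =>
    have h : ∑ i ∈ Finset.Icc 1 (2 * (p / 2)), xi p (-(i : ℤ)) * (g (-(i : ℤ)) - g (i : ℤ)
          + g (((N + 1 : ℕ) : ℤ) + (i : ℤ)) - g (((N + 1 : ℕ) : ℤ) - (i : ℤ))) =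
        ∑ i ∈ Finset.Icc 1 (2 * (p / 2)), xi p (-(i : ℤ))
          * (g (-(i : ℤ)) - g (i : ℤ) + g ((N : ℤ) + (i : ℤ)) - g ((N : ℤ) - (i : ℤ)))
        + ∑ i ∈ Finset.Icc 1 (2 * (p / 2)), xi p (-(i : ℤ)) * (g ((N : ℤ) + -(i : ℤ))
          + g ((N : ℤ) + (1 + (i : ℤ))) - g ((N : ℤ) + (1 - (i : ℤ))) - g ((N : ℤ) + (i : ℤ))) := by
      rw [← Finset.sum_add_distrib]
      refine Finset.sum_congr rfl fun i _ => ?_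
      rw [Nat.cast_add, Nat.cast_one, add_assoc, ← sub_eq_add_neg, ← add_sub_assoc]
      ring
    rw [Finset.sum_range_succ, ih, Finset.sum_range_succ,
      sum_window_tau_mul p fun j => g ((N : ℤ) + j), xi_zero, add_zero, h]
    ring

theorem trapezoid_eq_sum (f : ℝ → ℝ) (a b : ℝ) {N : ℕ} (hN : 1 ≤ N) :
    trapezoid f a b N = mesh a b N *
      ∑ k ∈ Finset.range N, (f (node a b N (k : ℤ)) + f (node a b N ((k : ℤ) + 1))) / 2 := by
  have h (g : ℤ → ℝ) (n : ℕ) : ∑ k ∈ Finset.range (n + 1), (g (k : ℤ) + g ((k : ℤ) + 1)) / 2 =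
      (g 0 + g ((n : ℤ) + 1)) / 2 + ∑ i ∈ Finset.Icc 1 n, g (i : ℤ) := by
    induction n with
    | zero => simp
    | succ n ih =>
      rw [Finset.sum_range_succ, ih, Finset.sum_Icc_succ_top (by omega)]
      push_cast
      ring
  obtain ⟨n, rfl⟩ : ∃ n, N = n + 1 := ⟨N - 1, by omega⟩
  rw [h (fun i => f (node a b (n + 1) i)), trapezoid, Nat.add_sub_cancel]
  push_cast
  ring

theorem correctedTrapezoid_eq_sum (p : ℕ) (f : ℝ → ℝ) (a b : ℝ) {N : ℕ} (hN : 1 ≤ N) :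
    correctedTrapezoid p f a b N = ∑ k ∈ Finset.range N,
      mesh a b N * ∑ j ∈ window p, tau p j * f (node a b N ((k : ℤ) + j)) := by
  rw [← Finset.mul_sum, sum_sum_tau_mul p N fun i => f (node a b N i), correctedTrapezoid,
    trapezoid_eq_sum f a b hN, mul_add]

/-! ### Error estimates -/

/-- Taylor expansion at c; compactness of the whole interval makes K independent of c. -/
theorem exists_polynomial_abs_sub_le {f : ℝ → ℝ} {α β : ℝ} {n : ℕ}
    (hf : ContDiffOn ℝ ((n + 1 : ℕ) : WithTop ℕ∞) f (Set.Icc α β)) :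
    ∃ K : ℝ, 0 ≤ K ∧ ∀ c, α ≤ c → c < β → ∃ P : ℝ[X], P.degree < (n + 1 : ℕ) ∧
      ∀ x ∈ Set.Icc c β, |f x - P.eval x| ≤ K * (x - c) ^ (n + 1) := by
  rcases le_or_gt β α with hαβ | hαβ
  · exact ⟨0, le_rfl, fun c h1 h2 => absurd (h1.trans_lt h2) (not_lt.2 hαβ)⟩
  have hu : UniqueDiffOn ℝ (Set.Icc α β) := uniqueDiffOn_Icc hαβ
  obtain ⟨K, hK⟩ := isCompact_Icc.exists_bound_of_continuousOn
    (hf.continuousOn_iteratedDerivWithin (m := n + 1) le_rfl hu)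
  have hK0 : 0 ≤ K := (norm_nonneg _).trans (hK α (Set.left_mem_Icc.2 hαβ.le))
  refine ⟨K / n.factorial, by positivity, fun c hc hcβ => ?_⟩
  have hsub : Set.Icc c β ⊆ Set.Icc α β := Set.Icc_subset_Icc_left hc
  refine ⟨∑ k ∈ Finset.range (n + 1),
    C ((k.factorial : ℝ)⁻¹ * iteratedDerivWithin k f (Set.Icc c β) c) * (X - C c) ^ k, ?_, ?_⟩
  · refine (degree_sum_le _ _).trans_lt ((Finset.sup_lt_iff (WithBot.bot_lt_coe _)).2 ?_)
    intro k hk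
    rw [← smul_eq_C_mul]
    refine (degree_smul_le _ _).trans_lt ?_
    rw [degree_pow, degree_X_sub_C, nsmul_one]
    exact Nat.cast_lt.2 (Finset.mem_range.1 hk)
  · intro x hx
    have h := taylor_mean_remainder_bound hcβ.le (n := n) (C := K)
      (by simpa using hf.mono hsub) hx fun y hy => by
        have := hK y (hsub hy)
        rw [iteratedDerivWithin_eq_iteratedFDerivWithin] at this ⊢
        rwa [iteratedFDerivWithin_subset hsub (uniqueDiffOn_Icc hcβ) hu hf hy]
    rw [taylor_within_apply, Real.norm_eq_abs] at h
    rw [eval_finsetSum]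
    refine (le_of_eq ?_).trans (h.trans (le_of_eq (by ring)))
    congr 2
    refine Finset.sum_congr rfl fun k _ => ?_
    simp only [eval_mul, eval_C, eval_pow, eval_sub, eval_X, smul_eq_mul]
    ring

theorem integral_polynomial_eq_sum_tau (p : ℕ) {P : ℝ[X]}
    (hP : P.degree < (2 * (p / 2) + 2 : ℕ)) (x h : ℝ) :
    ∫ t in x..x + h, P.eval t = h * ∑ j ∈ window p, tau p j * P.eval (x + j * h) := by
  have h1 : (P.comp (C h * X + C x)).degree < (2 * (p / 2) + 2 : ℕ) := by
    have h2 : P.natDegree < 2 * (p / 2) + 2 := by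
      by_cases h0 : P = 0
      · rw [h0, natDegree_zero]; omega
      · exact (natDegree_lt_iff_degree_lt h0).2 hP
    rw [degree_lt_iff_coeff_zero]
    intro m hm
    refine coeff_eq_zero_of_natDegree_lt ?_
    refine (natDegree_comp_le.trans ?_).trans_lt (h2.trans_le hm)
    exact (Nat.mul_le_mul_left _ natDegree_linear_le).trans (mul_one _).le
  have h2 := localDefect_eq_zero p h1
  rw [localDefect_apply, sub_eq_zero] at h2
  simp only [eval_comp, eval_add, eval_mul, eval_C, eval_X] at h2
  have h3 := intervalIntegral.smul_integral_comp_mul_add (a := 0) (b := 1)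
    (fun t => P.eval t) h x
  rw [← h2, smul_eq_mul] at h3
  rw [mul_zero, mul_one, zero_add, add_comm h x] at h3
  rw [← h3]
  simp only [mul_comm h, add_comm x]

/-- The rule is exact on P, so only f - P contributes: ε h from the integral and ε h ∑|τ| from the
sum. -/
theorem abs_integral_sub_sum_tau_le (p : ℕ) {P : ℝ[X]}
    (hP : P.degree < (2 * (p / 2) + 2 : ℕ)) {f : ℝ → ℝ} {x h ε : ℝ} (hh : 0 ≤ h)
    (hf : IntervalIntegrable f MeasureTheory.volume x (x + h))
    (hε : ∀ t ∈ Set.Icc (x - 2 * (p / 2 : ℕ) * h) (x + (2 * (p / 2 : ℕ) + 1) * h),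
      |f t - P.eval t| ≤ ε) :
    |(∫ t in x..x + h, f t) - h * ∑ j ∈ window p, tau p j * f (x + j * h)| ≤
      h * (1 + ∑ j ∈ window p, |tau p j|) * ε := by
  have hq : (0 : ℝ) ≤ (p / 2 : ℕ) := Nat.cast_nonneg _
  have h1 : |∫ t in x..x + h, (f t - P.eval t)| ≤ ε * h := by
    have := intervalIntegral.norm_integral_le_of_norm_le_const (a := x) (b := x + h) (C := ε)
      (f := fun t => f t - P.eval t) fun t ht => ?_
    · rwa [add_sub_cancel_left, abs_of_nonneg hh] at this
    · rw [Set.uIoc_of_le (by linarith)] at ht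
      refine hε t ⟨?_, ?_⟩
      · have : 0 ≤ 2 * ((p / 2 : ℕ) : ℝ) * h := by positivity
        linarith [ht.1]
      · have : 0 ≤ 2 * ((p / 2 : ℕ) : ℝ) * h := by positivity
        linarith [ht.2]
  rw [intervalIntegral.integral_sub hf (P.continuous.intervalIntegrable _ _),
    integral_polynomial_eq_sum_tau p hP] at h1
  have h2 : |∑ j ∈ window p, tau p j * (f (x + j * h) - P.eval (x + j * h))| ≤
      (∑ j ∈ window p, |tau p j|) * ε := by
    refine (Finset.abs_sum_le_sum_abs _ _).trans ?_
    rw [Finset.sum_mul]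
    refine Finset.sum_le_sum fun j hj => ?_
    rw [abs_mul]
    refine mul_le_mul_of_nonneg_left (hε _ ?_) (abs_nonneg _)
    rw [window, Finset.mem_Icc] at hj
    have hj1 := (Int.cast_le (R := ℝ)).2 hj.1
    have hj2 := (Int.cast_le (R := ℝ)).2 hj.2
    simp only [Int.cast_neg, Int.cast_mul, Int.cast_ofNat, Int.cast_natCast, Int.cast_add,
      Int.cast_one] at hj1 hj2
    constructor
    · nlinarith
    · nlinarith
  simp only [mul_sub, Finset.sum_sub_distrib] at h2
  have h3 := mul_le_mul_of_nonneg_left h2 hh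
  rw [← abs_of_nonneg hh, ← abs_mul, abs_of_nonneg hh] at h3
  rw [abs_le] at h1 h3 ⊢
  constructor <;> nlinarith [h1.1, h1.2, h3.1, h3.2]

theorem exists_abs_integral_sub_correctedTrapezoid_le (p : ℕ) {a b : ℝ} (hab : a < b) {N₀ : ℕ}
    (hN₀ : 1 ≤ N₀) {f : ℝ → ℝ}
    (hf : ContDiffOn ℝ ((2 * (p / 2) + 2 : ℕ) : WithTop ℕ∞) f (extendedInterval p a b N₀)) :
    ∃ K : ℝ, ∀ N : ℕ, N₀ ≤ N →
      |(∫ x in a..b, f x) - correctedTrapezoid p f a b N|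
        ≤ K * mesh a b N ^ (2 * (p / 2) + 2) := by
  obtain ⟨K, hK0, hK⟩ := exists_polynomial_abs_sub_le (n := 2 * (p / 2) + 1) hf
  have hcont : ContinuousOn f (extendedInterval p a b N₀) := hf.continuousOn
  rw [extendedInterval] at hcont
  set q := p / 2 with hq
  set S := 1 + ∑ j ∈ window p, |tau p j|
  -- N panels of width h give b - a, and 4q+1 is the length, in units of h, of the stretch of nodes
  -- used by one panel.
  refine ⟨(b - a) * S * K * (4 * q + 1) ^ (2 * q + 2), fun N hN => ?_⟩
  have hN1 : 1 ≤ N := hN₀.trans hN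
  have hNpos : (0 : ℝ) < N := by exact_mod_cast hN1
  have hN₀pos : (0 : ℝ) < N₀ := by exact_mod_cast hN₀
  set h := mesh a b N with hh
  have hpos : 0 < h := div_pos (sub_pos.2 hab) hNpos
  -- A finer mesh overhangs [a, b] less, so all nodes stay in the interval attached to `N₀`.
  have hle : h ≤ mesh a b N₀ :=
    div_le_div_of_nonneg_left (sub_pos.2 hab).le hN₀pos (by exact_mod_cast hN)
  have hNh : (N : ℝ) * h = b - a := mul_div_cancel₀ _ hNpos.ne'
  have hqle : 2 * (q : ℝ) * h ≤ 2 * (q : ℝ) * mesh a b N₀ :=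
    mul_le_mul_of_nonneg_left hle (by positivity)
  have hq0 : 0 ≤ (q : ℝ) * h := by positivity
  have hk0 (k : ℕ) : 0 ≤ (k : ℝ) * h := by positivity
  have hkN {k : ℕ} (hk : k < N) : ((k : ℝ) + 1) * h ≤ b - a := by
    rw [← hNh]
    exact mul_le_mul_of_nonneg_right (by exact_mod_cast hk) hpos.le
  have hint {k : ℕ} (hk : k < N) : IntervalIntegrable f MeasureTheory.volume
      (a + k * h) (a + k * h + h) := by
    refine ContinuousOn.intervalIntegrable_of_Icc (by linarith) (hcont.mono ?_)
    refine Set.Icc_subset_Icc ?_ ?_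
    · linarith [hk0 k]
    · linarith [hkN hk]
  have hsum : ∫ x in a..b, f x =
      ∑ k ∈ Finset.range N, ∫ x in (a + k * h)..(a + k * h + h), f x := by
    have := intervalIntegral.sum_integral_adjacent_intervals (f := f)
      (μ := MeasureTheory.volume) (a := fun k : ℕ => a + k * h) (n := N) fun k hk => by
        convert hint hk using 1
        push_cast
        ring
    simp only [Nat.cast_zero, zero_mul, add_zero, hNh, add_sub_cancel] at this
    rw [← this]
    refine Finset.sum_congr rfl fun k _ => ?_
    congr 1
    push_cast
    ring
  have hloc : ∀ k ∈ Finset.range N, |(∫ x in (a + k * h)..(a + k * h + h), f x) -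
      h * ∑ j ∈ window p, tau p j * f (node a b N ((k : ℤ) + j))| ≤
      h * S * (K * ((4 * q + 1) * h) ^ (2 * q + 2)) := by
    intro k hk
    rw [Finset.mem_range] at hk
    have hkN' := hkN hk
    -- Expand at the leftmost node of the panel's rule, since the Taylor bound is one-sided.
    obtain ⟨P, hP, hPf⟩ := hK (a + k * h - 2 * q * h) (by linarith [hk0 k])
      (by linarith [hk0 k])
    have hnode (j : ℤ) : node a b N ((k : ℤ) + j) = a + k * h + j * h := by
      rw [node, ← hh]; push_cast; ring
    simp only [hnode]
    refine abs_integral_sub_sum_tau_le p hP hpos.le (hint hk) fun t ht => ?_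
    refine (hPf t ⟨ht.1, ?_⟩).trans ?_
    · linarith [ht.2]
    · refine mul_le_mul_of_nonneg_left (pow_le_pow_left₀ ?_ ?_ _) hK0
      · linarith [ht.1]
      · linarith [ht.2]
  rw [correctedTrapezoid_eq_sum p f a b hN1, hsum, ← Finset.sum_sub_distrib]
  refine (Finset.abs_sum_le_sum_abs _ _).trans ((Finset.sum_le_sum hloc).trans (le_of_eq ?_))
  rw [Finset.sum_const, Finset.card_range, nsmul_eq_mul, mul_pow, ← hNh]
  ring

end BSplineQuadrature

end

open BSplineQuadrature
theorem mainTheorem1 (p : ℕ) (hp : 1 ≤ p) (a b : ℝ) (hab : a < b) (N₀ : ℕ) (hN₀ : 1 ≤ N₀)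
    (f : ℝ → ℝ) :
    (Odd p → ContDiffOn ℝ ((p + 1 : ℕ) : WithTop ℕ∞) f (extendedInterval p a b N₀) →
      ∃ K : ℝ, ∀ N : ℕ, N₀ ≤ N →
        |(∫ x in a..b, f x) - correctedTrapezoid p f a b N| ≤ K * mesh a b N ^ (p + 1)) ∧
    (Even p → ContDiffOn ℝ ((p + 2 : ℕ) : WithTop ℕ∞) f (extendedInterval p a b N₀) →
      ∃ K : ℝ, ∀ N : ℕ, N₀ ≤ N →
        |(∫ x in a..b, f x) - correctedTrapezoid p f a b N| ≤ K * mesh a b N ^ (p + 2)) := by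
  constructor
  · intro hodd hf
    have h : p + 1 = 2 * (p / 2) + 2 := by
      obtain ⟨k, rfl⟩ := hodd
      omega
    rw [h] at hf ⊢
    exact exists_abs_integral_sub_correctedTrapezoid_le p hab hN₀ hf
  · intro heven hf
    have h : p + 2 = 2 * (p / 2) + 2 := by rw [Nat.two_mul_div_two_of_even heven]
    rw [h] at hf ⊢
    exact exists_abs_integral_sub_correctedTrapezoid_le p hab hN₀ hf
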